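/- A channel on $M_n(\mathbb{C})$ ($n\ge 1$) is a completely positive, trace-preserving linear map $\Phi:M_n(\mathbb{C})\to M_n(\mathbb{C})$; a state is a positive semidefinite matrix of trace one. For a matrix $A$ let $\|A\|_p=\big(\mathrm{Tr}\,(A^*A)^{p/2}\big)^{1/p}$, and for a channel $\Phi$ let $\nu_p(\Phi)=\sup_\rho\|\Phi(\rho)\|_p$, the supremum being over all states $\rho$. Let $\Phi$ be a channel on $M_2(\mathbb{C})$ (a qubit channel). Suppose that after independent unitary changes of basis in its domain and range, that is, for some unitaries $U,V$, the map $A\mapsto U\,\Phi(VAV^*)\,U^*$ has, with respect to the basis $I,\sigma_1,\sigma_2,\sigma_3$ ($\sigma_i$ the Pauli matrices), the form $$\begin{pmatrix}1&0&0&0\\ t_1&\lambda_1&0&0\\ t_2&0&\lambda_2&0\\ t_3&0&0&\lambda_3\end{pmatrix}$$ with real parameters $t_i,\lambda_i$ such that, for all $i,j,k\in\{1,2,3\}$, $$\text{if }|\lambda_i|<|\lambda_j|<|\lambda_k|\ \text{ then }\ t_it_j=0 .$$ Theorem. For every $n\ge 1$, every channel $\Omega$ on $M_n(\mathbb{C})$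 and every integer $p\ge 1$, $$\nu_p(\Omega\otimes\Phi)=\nu_p(\Omega)\,\nu_p(\Phi).$$ -/

import Mathlib

open scoped Matrix Kronecker TensorProduct ComplexOrder

noncomputable section

/-- The trace power `Tr |A|^p = Tr (A* A)^(p/2)`; the power of the positive matrix `A* A` is taken
by the functional calculus of hermitian matrices. -/
def tracePow {n : Type*} [Fintype n] [DecidableEq n] (p : ℝ) (A : Matrix n n ℂ) : ℝ :=
  (Matrix.trace (cfc (fun x : ℝ => x ^ (p / 2)) (Aᴴ * A))).re

/-- The noncommutative `l_p` norm `‖A‖_p = (Tr (A* A)^(p/2))^(1/p)`. -/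
def schattenNorm {n : Type*} [Fintype n] [DecidableEq n] (p : ℝ) (A : Matrix n n ℂ) : ℝ :=
  tracePow p A ^ (1 / p)

/-- A state: a positive semidefinite matrix of trace one. -/
def IsState {n : Type*} [Fintype n] (ρ : Matrix n n ℂ) : Prop :=
  ρ.PosSemidef ∧ ρ.trace = 1

/-- The tensor product `Ω ⊗ Φ` of two maps on matrix algebras, acting on matrices indexed by pairs;
`(Ω ⊗ Φ) (A ⊗ₖ B) = Ω A ⊗ₖ Φ B`. -/
def tensorMap {m n : Type*} [Fintype m] [DecidableEq m] [Fintype n] [DecidableEq n]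
    (Ω : Matrix m m ℂ →ₗ[ℂ] Matrix m m ℂ) (Φ : Matrix n n ℂ →ₗ[ℂ] Matrix n n ℂ) :
    Matrix (m × n) (m × n) ℂ →ₗ[ℂ] Matrix (m × n) (m × n) ℂ :=
  (kroneckerLinearEquiv m m n n ℂ).toLinearMap ∘ₗ TensorProduct.map Ω Φ ∘ₗ
    (kroneckerLinearEquiv m m n n ℂ).symm.toLinearMap

/-- A quantum channel: a completely positive, trace-preserving linear map. Complete positivity
says that `I ⊗ Φ` is positive on `B(ℂ^k ⊗ H)` for every `k`. -/
structure IsChannel {n : Type*} [Fintype n] [DecidableEq n]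
    (Φ : Matrix n n ℂ →ₗ[ℂ] Matrix n n ℂ) : Prop where
  completelyPositive : ∀ (k : ℕ) (M : Matrix (Fin k × n) (Fin k × n) ℂ),
    M.PosSemidef → (tensorMap (LinearMap.id : Matrix (Fin k) (Fin k) ℂ →ₗ[ℂ] _) Φ M).PosSemidef
  tracePreserving : ∀ A : Matrix n n ℂ, (Φ A).trace = A.trace

/-- The maximal `l_p` norm `ν_p(Φ) = sup_ρ ‖Φ(ρ)‖_p` over all states `ρ`. -/
def maxNorm {n : Type*} [Fintype n] [DecidableEq n] (p : ℝ)
    (Φ : Matrix n n ℂ →ₗ[ℂ] Matrix n n ℂ) : ℝ :=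
  sSup ((fun ρ => schattenNorm p (Φ ρ)) '' {ρ | IsState ρ})

/-- The Pauli matrices `σ₁, σ₂, σ₃`, indexed by `0, 1, 2`. -/
def pauli : Fin 3 → Matrix (Fin 2) (Fin 2) ℂ :=
  ![!![0, 1; 1, 0], !![0, -Complex.I; Complex.I, 0], !![1, 0; 0, -1]]

/-- In the basis `I, σ₁, σ₂, σ₃` the map `Φ` has the matrix with rows
`(1, 0, 0, 0), (t₁, lam₁, 0, 0), (t₂, 0, lam₂, 0), (t₃, 0, 0, lam₃)`. -/
structure IsNormalForm (Φ : Matrix (Fin 2) (Fin 2) ℂ →ₗ[ℂ] Matrix (Fin 2) (Fin 2) ℂ)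
    (lam t : Fin 3 → ℝ) : Prop where
  map_one : Φ 1 = 1 + ∑ i, (t i : ℂ) • pauli i
  map_pauli : ∀ i, Φ (pauli i) = (lam i : ℂ) • pauli i

/-- Conjugation `A ↦ U A U*`. -/
def unitaryConj {n : Type*} [Fintype n] [DecidableEq n] (U : Matrix.unitaryGroup n ℂ) :
    Matrix n n ℂ →ₗ[ℂ] Matrix n n ℂ :=
  LinearMap.mulLeft ℂ (U : Matrix n n ℂ) ∘ₗ LinearMap.mulRight ℂ (U : Matrix n n ℂ)ᴴ

/-- `lam, t` are parameters of a normal form of `Φ`: independent unitary transformations in the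
domain and the range of `Φ` bring it into the normal form with these parameters. -/
def HasNormalForm (Φ : Matrix (Fin 2) (Fin 2) ℂ →ₗ[ℂ] Matrix (Fin 2) (Fin 2) ℂ)
    (lam t : Fin 3 → ℝ) : Prop :=
  ∃ U V : Matrix.unitaryGroup (Fin 2) ℂ, IsNormalForm (unitaryConj U ∘ₗ Φ ∘ₗ unitaryConj V) lam t


theorem schattenNorm_le_one {n : Type*} [Fintype n] [DecidableEq n] {p : ℝ} (hp : 1 ≤ p)
    {ρ : Matrix n n ℂ} (hρ : IsState ρ) : schattenNorm p ρ ≤ 1 := by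
  obtain ⟨h1, h2⟩ := hρ
  have hh := h1.isHermitian
  have hsa : IsSelfAdjoint ρ := hh
  have e1 : cfc (fun x : ℝ => x ^ (p / 2)) (ρᴴ * ρ) = cfc (fun x : ℝ => |x| ^ p) ρ := by
    have hsq : ρᴴ * ρ = cfc (fun x : ℝ => x ^ 2) ρ := by
      rw [cfc_pow_id (R := ℝ) ρ 2, hh.eq, pow_two]
    rw [hsq, ← cfc_comp' (fun x : ℝ => x ^ (p / 2)) (fun x : ℝ => x ^ 2) ρ
      (by exact (Real.continuous_rpow_const (by linarith)).continuousOn) (by fun_prop)]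
    congr 1
    ext x
    rw [← sq_abs, ← Real.rpow_natCast, ← Real.rpow_mul (abs_nonneg x)]
    congr 1
    push_cast
    ring
  have hsum : ∑ i, hh.eigenvalues i = 1 := by
    have := hh.trace_eq_sum_eigenvalues
    rw [h2] at this
    exact Complex.ofReal_injective (by rw [Complex.ofReal_sum]; simpa using this.symm)
  have hle : ∀ i, hh.eigenvalues i ≤ 1 := fun i => by
    rw [← hsum]
    exact Finset.single_le_sum (fun j _ => h1.eigenvalues_nonneg j) (Finset.mem_univ i)
  have e2 : tracePow p ρ = ∑ i, hh.eigenvalues i ^ p := by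
    rw [tracePow, e1, hh.cfc_eq, Matrix.IsHermitian.cfc, Unitary.conjStarAlgAut_apply,
      Matrix.trace_mul_comm, ← mul_assoc]
    simp [Matrix.trace, abs_of_nonneg (h1.eigenvalues_nonneg _)]
  have e3 : tracePow p ρ ≤ 1 := by
    rw [e2, ← hsum]
    refine Finset.sum_le_sum fun i _ => ?_
    calc hh.eigenvalues i ^ p ≤ hh.eigenvalues i ^ (1 : ℝ) :=
          Real.rpow_le_rpow_of_exponent_ge' (h1.eigenvalues_nonneg i) (hle i) zero_le_one hp
      _ = _ := Real.rpow_one _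
  have e4 : 0 ≤ tracePow p ρ := by
    rw [e2]
    exact Finset.sum_nonneg fun i _ => Real.rpow_nonneg (h1.eigenvalues_nonneg i) _
  exact Real.rpow_le_one e4 e3 (by positivity)

theorem tensorMap_kronecker {m n : Type*} [Fintype m] [DecidableEq m] [Fintype n] [DecidableEq n]
    (Ω : Matrix m m ℂ →ₗ[ℂ] Matrix m m ℂ) (Φ : Matrix n n ℂ →ₗ[ℂ] Matrix n n ℂ)
    (A : Matrix m m ℂ) (B : Matrix n n ℂ) : tensorMap Ω Φ (A ⊗ₖ B) = Ω A ⊗ₖ Φ B := by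
  simp [tensorMap]

theorem tensorMap_id_apply {m n : Type*} [Fintype m] [DecidableEq m] [Fintype n] [DecidableEq n]
    (Φ : Matrix n n ℂ →ₗ[ℂ] Matrix n n ℂ) (M : Matrix (m × n) (m × n) ℂ) (i j : m) (a b : n) :
    tensorMap (LinearMap.id : Matrix m m ℂ →ₗ[ℂ] _) Φ M (i, a) (j, b) =
      Φ (Matrix.of fun c d => M (i, c) (j, d)) a b := by
  have key : M = ∑ k : m, ∑ l : m,
      (Matrix.single k l (1:ℂ)) ⊗ₖ (Matrix.of fun c d => M (k, c) (l, d)) := by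
    ext ⟨x, c⟩ ⟨y, d⟩
    simp [Matrix.sum_apply, Matrix.kroneckerMap_apply, Matrix.single_apply, ite_and]
  conv_lhs => rw [key]
  simp only [map_sum, tensorMap_kronecker, Matrix.sum_apply, Matrix.kroneckerMap_apply,
    LinearMap.id_apply]
  simp [Matrix.single_apply, ite_and]

/-- The image of a state under a channel is a state. -/
theorem IsChannel.isState {n : Type*} [Fintype n] [DecidableEq n]
    {Φ : Matrix n n ℂ →ₗ[ℂ] Matrix n n ℂ} (h : IsChannel Φ) {ρ : Matrix n n ℂ} (hρ : IsState ρ) :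
    IsState (Φ ρ) := by
  refine ⟨?_, by rw [h.tracePreserving, hρ.2]⟩
  have hM := h.completelyPositive 1 (ρ.submatrix Prod.snd Prod.snd) (hρ.1.submatrix _)
  have e : Φ ρ = (tensorMap (LinearMap.id : Matrix (Fin 1) (Fin 1) ℂ →ₗ[ℂ] _) Φ
      (ρ.submatrix Prod.snd Prod.snd)).submatrix (fun a => ((0 : Fin 1), a))
        (fun a => ((0 : Fin 1), a)) := by
    ext a b
    rw [Matrix.submatrix_apply, tensorMap_id_apply]
    rfl
  rw [e]
  exact hM.submatrix _

/-- For a channel and `p ≥ 1` the supremum that defines `ν_p` is taken over a bounded set. -/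
theorem IsChannel.bddAbove_maxNorm {n : Type*} [Fintype n] [DecidableEq n] {p : ℝ} (hp : 1 ≤ p)
    {Φ : Matrix n n ℂ →ₗ[ℂ] Matrix n n ℂ} (h : IsChannel Φ) :
    BddAbove ((fun ρ => schattenNorm p (Φ ρ)) '' {ρ | IsState ρ}) := by
  refine ⟨1, ?_⟩
  rintro _ ⟨ρ, hρ, rfl⟩
  exact schattenNorm_le_one hp (h.isState hρ)

end

/-!
The proof rests on entrywise positivity. Suppose that a channel `Φ` maps every matrix unit `E_ij` to
a matrix with nonnegative entries. For a state `M` with blocks `M_ij`,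

  `(Ω ⊗ Φ) M = ∑ i j, Ω M_ij ⊗ Φ E_ij`,

and the trace of the `p`-th power of this sum expands into products of `p` of the `Ω M_ij`, with
coefficients that are traces of products of the `Φ E_ij` and so are nonnegative. As `Ω` is completely
positive, the matrix of blocks `Ω M_ij` is positive, `Ω M_ij = C_iᴴ C_j`, and Hölder's inequality
for `2 * p` factors bounds each trace by the product of the numbers `b_i b_j`, where
`b_i ^ 2 = ν_p(Ω) tr M_ii` (`norm_trace_prod_blocks_le`). Putting these bounds back into the
expansion gives `tr (Φ N) ^ p` for the rank-one matrix `N = b bᵀ`, of trace `ν_p(Ω)`; this is at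
most `(ν_p(Ω) ν_p(Φ)) ^ p` (`norm_trace_tensorMap_pow_le`). Product states give the opposite
inequality.

The form of Hölder's inequality that is needed, `norm_trace_word_le`, is proved by the reflection
argument behind chessboard estimates. Among the words of length `2 * p` in finitely many normalized
letters and their adjoints, take one with the largest trace; by the Cauchy–Schwarz inequality it
stays maximal when half of it is replaced by the reflection of the other half, and repeated
reflections turn it into `X Xᴴ X Xᴴ ⋯`.

A qubit channel in normal form maps `E_00` and `E_11` to matrices with off-diagonal entries
`(t₁ ± i t₂) / 2`, and maps `E_01` and `E_10` to off-diagonal matrices with entries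
`(λ₁ ± λ₂) / 2`. Diagonal unitaries change the phases of these numbers and make all of them
nonnegative if `|λ₁| = |λ₂|`, or if one of the axes `1, 2` has `t = 0` and is not the longer one
(`IsNormalForm.exists_entrywise_nonneg`). The hypothesis on the parameters says that some pair of
axes has this property, and a rotation moves that pair to the places `1, 2`. None of the quantities
involved changes under unitary changes of basis.
-/

noncomputable section

/-! ### Hölder's inequality for traces of words -/

/-- The Cauchy–Schwarz inequality for the Hilbert–Schmidt inner product. -/
theorem norm_trace_mul_sq_le {N : Type*} [Fintype N] (A B : Matrix N N ℂ) :
    ‖(A * B).trace‖ ^ 2 ≤ ‖(A * Aᴴ).trace‖ * ‖(Bᴴ * B).trace‖ := by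
  have key : ∀ C : Matrix N N ℂ, (C * Cᴴ).trace = ((∑ x : N × N, ‖C x.1 x.2‖ ^ 2 : ℝ) : ℂ) := by
    intro C
    simp [Matrix.trace, Matrix.mul_apply, Fintype.sum_prod_type, Complex.mul_conj']
  have hA : ‖(A * Aᴴ).trace‖ = ∑ x : N × N, ‖A x.1 x.2‖ ^ 2 := by
    rw [key, Complex.norm_of_nonneg (Finset.sum_nonneg fun _ _ => sq_nonneg _)]
  have hB : ‖(Bᴴ * B).trace‖ = ∑ x : N × N, ‖B x.2 x.1‖ ^ 2 := by
    rw [Matrix.trace_mul_comm, key,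
      Complex.norm_of_nonneg (Finset.sum_nonneg fun _ _ => sq_nonneg _),
      Fintype.sum_prod_type, Fintype.sum_prod_type_right]
  rw [hA, hB]
  refine le_trans ?_ (Finset.sum_mul_sq_le_sq_mul_sq Finset.univ
    (fun x : N × N => ‖A x.1 x.2‖) (fun x => ‖B x.2 x.1‖))
  gcongr
  have : (A * B).trace = ∑ x : N × N, A x.1 x.2 * B x.2 x.1 := by
    simp [Matrix.trace, Matrix.mul_apply, Fintype.sum_prod_type]
  rw [this]
  exact (norm_sum_le _ _).trans_eq (by simp)

section Words

variable {N α : Type*} [Fintype N] [DecidableEq N] (X : α → Matrix N N ℂ) {σ : α → α}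

/-- The letters are matrices `X a`, with `X (σ a)` the adjoint of `X a`; reversing a word and
applying `σ` to its letters gives the adjoint of its product. -/
theorem prod_map_adjoint_word (hX : ∀ a, X (σ a) = (X a)ᴴ) (l : List α) :
    ((l.map σ).reverse.map X).prod = ((l.map X).prod)ᴴ := by
  rw [Matrix.conjTranspose_list_prod, List.map_reverse, List.map_map, List.map_map]
  congr 3
  funext a
  exact hX a

theorem alternating_word_mul_conjTranspose (hX : ∀ a, X (σ a) = (X a)ᴴ) (r : ℕ) (a : α) :
    (((List.iterate σ a r).map X).prod) * (((List.iterate σ a r).map X).prod)ᴴ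
      = (X a * (X a)ᴴ) ^ r := by
  induction r generalizing a with
  | zero => simp
  | succ r ih =>
    have h := ih (σ a)
    rw [hX, Matrix.conjTranspose_conjTranspose] at h
    simp only [List.iterate, List.map_cons, List.prod_cons, Matrix.conjTranspose_mul]
    rw [← Matrix.mul_assoc, Matrix.mul_assoc (X a), h, ← mul_pow_mul]
    rw [pow_succ]
    simp only [Matrix.mul_assoc]

/-- By Cauchy–Schwarz, a word `u v` of maximal trace stays maximal when its first half `u` is
replaced by the reflection of its second half `v`. -/
theorem maximal_word_reflect (hX : ∀ a, X (σ a) = (X a)ᴴ)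
    {p : ℕ} {m : ℝ} (hm : 0 < m)
    (hle : ∀ l : List α, l.length = 2 * p → ‖((l.map X).prod).trace‖ ≤ m)
    {u v : List α} (hu : u.length = p) (hv : v.length = p)
    (huv : ‖(((u ++ v).map X).prod).trace‖ = m) :
    ‖((((v.map σ).reverse ++ v).map X).prod).trace‖ = m := by
  have h1 := norm_trace_mul_sq_le ((u.map X).prod) ((v.map X).prod)
  rw [← List.prod_append, ← List.map_append, huv] at h1
  have h2 := hle (u ++ (u.map σ).reverse) (by simp; omega)
  have h3 := hle ((v.map σ).reverse ++ v) (by simp; omega)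
  rw [List.map_append, List.prod_append, prod_map_adjoint_word X hX] at h2 h3 ⊢
  refine le_antisymm h3 ?_
  have h4 : m * m ≤ m * ‖(((v.map X).prod)ᴴ * (v.map X).prod).trace‖ := by
    rw [← sq]
    exact h1.trans (by gcongr)
  exact le_of_mul_le_mul_left h4 hm

theorem norm_trace_word_append_comm (u v : List α) :
    ‖(((u ++ v).map X).prod).trace‖ = ‖(((v ++ u).map X).prod).trace‖ := by
  simp only [List.map_append, List.prod_append]
  rw [Matrix.trace_mul_comm]

/-- Some maximal word opens with an alternating run `a, σ a, a, …` of any length up to `p`: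
reflecting a maximal word at the start of a run makes the run longer. -/
theorem exists_maximal_word_with_run (hX : ∀ a, X (σ a) = (X a)ᴴ) (hσ : Function.Involutive σ)
    {p : ℕ} {m : ℝ} (hm : 0 < m)
    (hle : ∀ l : List α, l.length = 2 * p → ‖((l.map X).prod).trace‖ ≤ m)
    {l : List α} (hl : l.length = 2 * p) (hlm : ‖((l.map X).prod).trace‖ = m)
    {r : ℕ} (hr : 1 ≤ r) (hrp : r ≤ p) :
    ∃ (a : α) (s : List α), (List.iterate σ a r ++ s).length = 2 * p ∧
      ‖(((List.iterate σ a r ++ s).map X).prod).trace‖ = m := by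
  induction r, hr using Nat.le_induction with
  | base =>
    cases l with
    | nil => simp at hl; omega
    | cons a s => exact ⟨a, s, by simpa using hl, by simpa using hlm⟩
  | succ r hr ih =>
    obtain ⟨a, s, hs, hsm⟩ := ih (by omega)
    simp only [List.length_append, List.length_iterate] at hs
    obtain ⟨k, rfl⟩ : ∃ k, r = k + 1 := ⟨r - 1, by omega⟩
    -- rotate the word so that the run opens its second half
    rw [← List.take_append_drop (p - (k + 1)) s, ← List.append_assoc,
      norm_trace_word_append_comm] at hsm
    have h := maximal_word_reflect X hX hm hle (by simp; omega) (by simp; omega) hsm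
    set s₁ := s.take (p - (k + 1)) with hs₁
    have hl₁ : s₁.length = p - (k + 1) := by simp [hs₁]; omega
    refine ⟨σ a, s₁ ++ ((s₁.map σ).reverse ++ ((List.iterate σ (σ a) k).map σ).reverse), ?_, ?_⟩
    · simp [hl₁]
      omega
    · rw [← h, ← List.append_assoc, norm_trace_word_append_comm]
      simp [List.iterate, hσ a]

/-- A chessboard estimate. Among all words of length `2 * p` with the largest trace, one is
completely alternating by reflection, so its trace is that of some `(X a * (X a)ᴴ) ^ p`. -/
theorem norm_trace_word_le_one [Finite α] (hX : ∀ a, X (σ a) = (X a)ᴴ)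
    (hσ : Function.Involutive σ) {p : ℕ} (hp : 1 ≤ p)
    (h1 : ∀ a, ‖((X a * (X a)ᴴ) ^ p).trace‖ ≤ 1) {l : List α} (hl : l.length = 2 * p) :
    ‖((l.map X).prod).trace‖ ≤ 1 := by
  obtain ⟨w, hw, hmax⟩ := Set.exists_max_image {l : List α | l.length = 2 * p}
    (fun l => ‖((l.map X).prod).trace‖) (List.finite_length_eq α (2 * p)) ⟨l, hl⟩
  refine (hmax l hl).trans ?_
  rcases (norm_nonneg ((w.map X).prod).trace).eq_or_lt with h0 | hpos
  · exact h0.symm.le.trans zero_le_one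
  obtain ⟨a, s, hs, hsm⟩ := exists_maximal_word_with_run X hX hσ hpos hmax hw rfl hp le_rfl
  simp only [List.length_append, List.length_iterate] at hs
  rw [norm_trace_word_append_comm] at hsm
  have h := maximal_word_reflect X hX hpos hmax (by omega) (by simp) hsm
  rw [List.map_append, List.prod_append, prod_map_adjoint_word X hX, Matrix.trace_mul_comm,
    alternating_word_mul_conjTranspose X hX] at h
  exact h.symm.le.trans (h1 a)

/-- Hölder's inequality for a trace of `2 * p` factors, each measured in the Schatten norm of
exponent `2 * p`. -/
theorem norm_trace_word_le [Finite α] (hX : ∀ a, X (σ a) = (X a)ᴴ)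
    (hσ : Function.Involutive σ) {p : ℕ} (hp : 1 ≤ p) {b : α → ℝ} (hb : ∀ a, 0 ≤ b a)
    (hbσ : ∀ a, b (σ a) = b a)
    (h1 : ∀ a, ‖((X a * (X a)ᴴ) ^ p).trace‖ ≤ b a ^ (2 * p)) {l : List α}
    (hl : l.length = 2 * p) :
    ‖((l.map X).prod).trace‖ ≤ (l.map b).prod := by
  -- If some `b a` vanishes, the letters cannot be normalized; so `b` is first enlarged by `ε`.
  have key : ∀ ε : ℝ, 0 < ε → ‖((l.map X).prod).trace‖ ≤ (l.map fun a => b a + ε).prod := by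
    intro ε hε
    have hpos : ∀ a, 0 < b a + ε := fun a => add_pos_of_nonneg_of_pos (hb a) hε
    set c : α → ℂ := fun a => ((b a + ε : ℝ) : ℂ) with hc
    have hc0 : ∀ a, c a ≠ 0 := fun a => by simpa only [hc, Complex.ofReal_ne_zero] using (hpos a).ne'
    have hcn : ∀ a, ‖c a‖ = b a + ε := fun a => Complex.norm_of_nonneg (hpos a).le
    have hcs : ∀ a, star (c a) = c a := fun a => Complex.conj_ofReal _
    have hY := norm_trace_word_le_one (fun a => (c a)⁻¹ • X a) (σ := σ)
      (fun a => by
        rw [Matrix.conjTranspose_smul, star_inv₀, hcs, hX]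
        simp only [hc, hbσ]) hσ hp
      (fun a => by
        rw [Matrix.conjTranspose_smul, star_inv₀, hcs, smul_mul_smul_comm, smul_pow,
          Matrix.trace_smul, norm_smul, norm_pow, norm_mul, norm_inv, hcn, ← sq, ← pow_mul,
          inv_pow, inv_mul_le_one₀ (pow_pos (hpos a) _)]
        exact (h1 a).trans (pow_le_pow_left₀ (hb a) (by linarith) _)) hl
    have hsc : ∀ l : List α, (l.map X).prod
        = (l.map c).prod • (l.map fun a => (c a)⁻¹ • X a).prod := by
      intro l
      induction l with
      | nil => simp
      | cons a l ih =>
        rw [List.map_cons, List.map_cons, List.map_cons, List.prod_cons, List.prod_cons,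
          List.prod_cons, ← smul_mul_smul_comm, smul_inv_smul₀ (hc0 a), ← ih]
    have hcl : ‖(l.map c).prod‖ = (l.map fun a => b a + ε).prod := by
      clear hl hY
      induction l with
      | nil => simp
      | cons a l ih => simp only [List.map_cons, List.prod_cons, norm_mul, ih, hcn]
    rw [hsc, Matrix.trace_smul, norm_smul, hcl]
    exact mul_le_of_le_one_right (List.prod_nonneg (by
      simp only [List.mem_map]
      rintro _ ⟨a, -, rfl⟩
      exact (hpos a).le)) hY
  have hcont : Continuous fun ε : ℝ => (l.map fun a => b a + ε).prod :=
    continuous_list_prod l fun a _ => by fun_prop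
  have ht := (hcont.tendsto 0).mono_left (nhdsWithin_le_nhds (s := Set.Ioi 0))
  simp only [add_zero] at ht
  exact ge_of_tendsto ht (Filter.eventually_of_mem self_mem_nhdsWithin key)

end Words

/-! ### Schatten norms of positive matrices at integer exponents -/

theorem tracePow_natCast {n : Type*} [Fintype n] [DecidableEq n] {A : Matrix n n ℂ}
    (hA : A.PosSemidef) (p : ℕ) : tracePow (p : ℝ) A = ((A ^ p).trace).re := by
  have hh := hA.isHermitian
  have hsa : IsSelfAdjoint A := hh
  have hsq : Aᴴ * A = cfc (fun x : ℝ => x ^ 2) A := by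
    rw [cfc_pow_id (R := ℝ) A 2, hh.eq, pow_two]
  rw [tracePow, hsq, ← cfc_comp' (fun x : ℝ => x ^ ((p : ℝ) / 2)) (fun x : ℝ => x ^ 2) A
    (by exact (Real.continuous_rpow_const (by positivity)).continuousOn) (by fun_prop),
    ← cfc_pow_id (R := ℝ) A p]
  congr 2
  refine cfc_congr fun x hx => ?_
  rw [hh.spectrum_real_eq_range_eigenvalues] at hx
  obtain ⟨i, rfl⟩ := hx
  rw [← Real.rpow_natCast _ 2, ← Real.rpow_natCast, ← Real.rpow_mul (hA.eigenvalues_nonneg i)]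
  congr 1
  push_cast
  ring

theorem norm_trace_eq_re {n : Type*} [Fintype n] {A : Matrix n n ℂ} (hA : A.PosSemidef) :
    ‖A.trace‖ = A.trace.re := by
  have h := congrArg Complex.re (Complex.norm_of_nonneg' hA.trace_nonneg)
  rwa [Complex.ofReal_re] at h

theorem schattenNorm_pow {n : Type*} [Fintype n] [DecidableEq n] {A : Matrix n n ℂ}
    (hA : A.PosSemidef) {p : ℕ} (hp : 1 ≤ p) :
    schattenNorm (p : ℝ) A ^ p = ‖(A ^ p).trace‖ := by
  rw [norm_trace_eq_re (hA.pow p), ← tracePow_natCast hA, schattenNorm, one_div,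
    Real.rpow_inv_natCast_pow _ (by omega)]
  rw [tracePow_natCast hA, ← norm_trace_eq_re (hA.pow p)]
  exact norm_nonneg _

theorem schattenNorm_nonneg {n : Type*} [Fintype n] [DecidableEq n] {A : Matrix n n ℂ}
    (hA : A.PosSemidef) (p : ℕ) : 0 ≤ schattenNorm (p : ℝ) A := by
  refine Real.rpow_nonneg ?_ _
  rw [tracePow_natCast hA, ← norm_trace_eq_re (hA.pow p)]
  exact norm_nonneg _

theorem schattenNorm_kronecker {m n : Type*} [Fintype m] [DecidableEq m] [Fintype n]
    [DecidableEq n] {A : Matrix m m ℂ} {B : Matrix n n ℂ} (hA : A.PosSemidef)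
    (hB : B.PosSemidef) {p : ℕ} (hp : 1 ≤ p) :
    schattenNorm (p : ℝ) (A ⊗ₖ B) = schattenNorm (p : ℝ) A * schattenNorm (p : ℝ) B := by
  have hpow : (A ⊗ₖ B) ^ p = (A ^ p) ⊗ₖ (B ^ p) := by
    clear hp
    induction p with
    | zero => simp
    | succ p ih => rw [pow_succ, pow_succ, pow_succ, ih, Matrix.mul_kronecker_mul]
  refine (pow_left_inj₀ (schattenNorm_nonneg (hA.kronecker hB) p)
    (mul_nonneg (schattenNorm_nonneg hA p) (schattenNorm_nonneg hB p)) (by omega : p ≠ 0)).1 ?_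
  rw [mul_pow, schattenNorm_pow hA hp, schattenNorm_pow hB hp,
    schattenNorm_pow (hA.kronecker hB) hp, hpow, Matrix.trace_kronecker, norm_mul]

theorem maxNorm_nonneg {n : Type*} [Fintype n] [DecidableEq n]
    {Φ : Matrix n n ℂ →ₗ[ℂ] Matrix n n ℂ} (hΦ : IsChannel Φ) (p : ℕ) :
    0 ≤ maxNorm (p : ℝ) Φ := by
  refine Real.sSup_nonneg ?_
  rintro _ ⟨ρ, hρ, rfl⟩
  exact schattenNorm_nonneg (hΦ.isState hρ).1 p

/-- The bound that defines `maxNorm`, for positive matrices of arbitrary trace. -/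
theorem IsChannel.norm_trace_pow_le {n : Type*} [Fintype n] [DecidableEq n]
    {Φ : Matrix n n ℂ →ₗ[ℂ] Matrix n n ℂ} (hΦ : IsChannel Φ) {p : ℕ} (hp : 1 ≤ p)
    {A : Matrix n n ℂ} (hA : A.PosSemidef) :
    ‖((Φ A) ^ p).trace‖ ≤ (maxNorm (p : ℝ) Φ * A.trace.re) ^ p := by
  have hτ : A.trace = (A.trace.re : ℂ) := by
    rw [← norm_trace_eq_re hA, Complex.norm_of_nonneg' hA.trace_nonneg]
  set τ := A.trace.re with hτd
  have hτ0 : 0 ≤ τ := by rw [hτd, ← norm_trace_eq_re hA]; exact norm_nonneg _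
  rcases hτ0.eq_or_lt with h0 | hpos
  · have : A = 0 := hA.trace_eq_zero_iff.1 (by rw [hτ, ← h0, Complex.ofReal_zero])
    rw [this, map_zero, zero_pow (by omega), Matrix.trace_zero, norm_zero, ← h0, mul_zero,
      zero_pow (by omega)]
  · have hτne : (τ : ℂ) ≠ 0 := by simpa using hpos.ne'
    have hρ : IsState ((τ : ℂ)⁻¹ • A) := by
      refine ⟨hA.smul (by rw [← Complex.ofReal_inv]; exact_mod_cast inv_nonneg.2 hτ0), ?_⟩
      rw [Matrix.trace_smul, hτ, smul_eq_mul, inv_mul_cancel₀ hτne]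
    have h1 : schattenNorm (p : ℝ) (Φ ((τ : ℂ)⁻¹ • A)) ≤ maxNorm (p : ℝ) Φ :=
      le_csSup (hΦ.bddAbove_maxNorm (by exact_mod_cast hp)) ⟨_, hρ, rfl⟩
    have h2 := pow_le_pow_left₀ (schattenNorm_nonneg (hΦ.isState hρ).1 p) h1 p
    rw [schattenNorm_pow (hΦ.isState hρ).1 hp, map_smul, smul_pow, Matrix.trace_smul, norm_smul,
      norm_pow, norm_inv, Complex.norm_of_nonneg hτ0, inv_pow,
      inv_mul_le_iff₀ (pow_pos hpos _), ← mul_pow, mul_comm] at h2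
    exact h2

/-! ### Tensor products of channels -/

theorem linearMap_ext_kronecker {m n E : Type*} [Fintype m] [DecidableEq m] [Fintype n]
    [DecidableEq n] [AddCommMonoid E] [Module ℂ E]
    {f g : Matrix (m × n) (m × n) ℂ →ₗ[ℂ] E}
    (h : ∀ (A : Matrix m m ℂ) (B : Matrix n n ℂ), f (A ⊗ₖ B) = g (A ⊗ₖ B)) : f = g := by
  have : f ∘ₗ (kroneckerLinearEquiv m m n n ℂ).toLinearMap
      = g ∘ₗ (kroneckerLinearEquiv m m n n ℂ).toLinearMap :=
    TensorProduct.ext' fun A B => by simpa using h A B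
  ext1 M
  simpa using LinearMap.congr_fun this ((kroneckerLinearEquiv m m n n ℂ).symm M)

theorem tensorMap_apply {m n : Type*} [Fintype m] [DecidableEq m] [Fintype n] [DecidableEq n]
    (Ω : Matrix m m ℂ →ₗ[ℂ] Matrix m m ℂ) (Φ : Matrix n n ℂ →ₗ[ℂ] Matrix n n ℂ)
    (M : Matrix (m × n) (m × n) ℂ) :
    tensorMap Ω Φ M = ∑ x : n × n,
      Ω (M.submatrix (·, x.1) (·, x.2)) ⊗ₖ Φ (Matrix.single x.1 x.2 1) := by
  have key : M = ∑ x : n × n,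
      (M.submatrix (·, x.1) (·, x.2)) ⊗ₖ (Matrix.single x.1 x.2 (1 : ℂ)) := by
    ext ⟨x, c⟩ ⟨y, d⟩
    simp [Matrix.sum_apply, Matrix.kroneckerMap_apply, Matrix.single_apply, ite_and,
      Fintype.sum_prod_type]
  conv_lhs => rw [key]
  simp only [map_sum, tensorMap_kronecker]

theorem map_eq_sum_single {n : Type*} [Fintype n] [DecidableEq n]
    (Φ : Matrix n n ℂ →ₗ[ℂ] Matrix n n ℂ) (A : Matrix n n ℂ) :
    Φ A = ∑ x : n × n, A x.1 x.2 • Φ (Matrix.single x.1 x.2 1) := by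
  conv_lhs => rw [Matrix.matrix_eq_sum_single A]
  simp [Fintype.sum_prod_type, ← map_smul, Matrix.smul_single]

/-- Complete positivity, with an arbitrary finite index type for the auxiliary system. -/
theorem IsChannel.posSemidef_tensorMap_id {κ n : Type*} [Fintype κ] [DecidableEq κ] [Fintype n]
    [DecidableEq n] {Φ : Matrix n n ℂ →ₗ[ℂ] Matrix n n ℂ} (hΦ : IsChannel Φ)
    {M : Matrix (κ × n) (κ × n) ℂ} (hM : M.PosSemidef) :
    (tensorMap (LinearMap.id : Matrix κ κ ℂ →ₗ[ℂ] _) Φ M).PosSemidef := by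
  let e := Fintype.equivFin κ
  have h := (hΦ.completelyPositive _ _ (hM.submatrix (Prod.map e.symm id))).submatrix
    (Prod.map e id)
  convert h using 1
  ext ⟨i, a⟩ ⟨j, b⟩
  rw [tensorMap_id_apply, Matrix.submatrix_apply]
  simp only [Prod.map_apply, id_eq]
  rw [tensorMap_id_apply]
  simp

/-- `Ω ⊗ Φ = (I ⊗ Φ) (Ω ⊗ I)`, where `Ω ⊗ I` is written as `I ⊗ Ω` between two exchanges of the
factors, the form in which complete positivity of `Ω` is stated. -/
theorem tensorMap_eq_comp {m n : Type*} [Fintype m] [DecidableEq m] [Fintype n] [DecidableEq n]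
    (Ω : Matrix m m ℂ →ₗ[ℂ] Matrix m m ℂ) (Φ : Matrix n n ℂ →ₗ[ℂ] Matrix n n ℂ)
    (M : Matrix (m × n) (m × n) ℂ) :
    tensorMap Ω Φ M = tensorMap LinearMap.id Φ ((tensorMap LinearMap.id Ω
      (M.submatrix Prod.swap Prod.swap)).submatrix Prod.swap Prod.swap) := by
  ext ⟨x, k⟩ ⟨y, l⟩
  rw [tensorMap_id_apply, map_eq_sum_single Φ, tensorMap_apply Ω Φ, Matrix.sum_apply,
    Matrix.sum_apply]
  refine Finset.sum_congr rfl fun z _ => ?_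
  rw [Matrix.smul_apply, Matrix.of_apply, Matrix.submatrix_apply, Prod.swap_prod_mk,
    Prod.swap_prod_mk, tensorMap_id_apply]
  rfl

theorem posSemidef_tensorMap {m n : Type*} [Fintype m] [DecidableEq m] [Fintype n] [DecidableEq n]
    {Ω : Matrix m m ℂ →ₗ[ℂ] Matrix m m ℂ} (hΩ : IsChannel Ω)
    {Φ : Matrix n n ℂ →ₗ[ℂ] Matrix n n ℂ} (hΦ : IsChannel Φ)
    {M : Matrix (m × n) (m × n) ℂ} (hM : M.PosSemidef) : (tensorMap Ω Φ M).PosSemidef := by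
  rw [tensorMap_eq_comp]
  exact hΦ.posSemidef_tensorMap_id ((hΩ.posSemidef_tensorMap_id (hM.submatrix _)).submatrix _)

/-! ### Unitary changes of basis -/

theorem unitaryConj_apply {n : Type*} [Fintype n] [DecidableEq n] (U : Matrix.unitaryGroup n ℂ)
    (A : Matrix n n ℂ) :
    unitaryConj U A = (U : Matrix n n ℂ) * A * (U : Matrix n n ℂ)ᴴ := by
  simp [unitaryConj, Matrix.mul_assoc]

theorem posSemidef_unitaryConj {n : Type*} [Fintype n] [DecidableEq n]
    (U : Matrix.unitaryGroup n ℂ) {A : Matrix n n ℂ} (hA : A.PosSemidef) :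
    (unitaryConj U A).PosSemidef := by
  rw [unitaryConj_apply]
  exact hA.mul_mul_conjTranspose_same _

theorem unitaryConj_comp {n : Type*} [Fintype n] [DecidableEq n]
    (U V : Matrix.unitaryGroup n ℂ) :
    unitaryConj U ∘ₗ unitaryConj V = unitaryConj (U * V) := by
  ext1 A
  simp [unitaryConj_apply, Matrix.mul_assoc]

theorem unitaryConj_one {n : Type*} [Fintype n] [DecidableEq n] :
    unitaryConj (1 : Matrix.unitaryGroup n ℂ) = LinearMap.id := by
  ext1 A
  simp [unitaryConj_apply]

theorem trace_unitaryConj {n : Type*} [Fintype n] [DecidableEq n] (U : Matrix.unitaryGroup n ℂ)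
    (A : Matrix n n ℂ) : (unitaryConj U A).trace = A.trace := by
  have h : (U : Matrix n n ℂ)ᴴ * (U : Matrix n n ℂ) = 1 := Unitary.coe_star_mul_self U
  rw [unitaryConj_apply, Matrix.trace_mul_comm, ← Matrix.mul_assoc, h, Matrix.one_mul]

theorem isState_unitaryConj {n : Type*} [Fintype n] [DecidableEq n] (U : Matrix.unitaryGroup n ℂ)
    {A : Matrix n n ℂ} (hA : IsState A) : IsState (unitaryConj U A) :=
  ⟨posSemidef_unitaryConj U hA.1, by rw [trace_unitaryConj, hA.2]⟩

theorem schattenNorm_unitaryConj {n : Type*} [Fintype n] [DecidableEq n] {p : ℝ} (hp : 0 ≤ p)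
    (U : Matrix.unitaryGroup n ℂ) (A : Matrix n n ℂ) :
    schattenNorm p (unitaryConj U A) = schattenNorm p A := by
  have h1 : ((unitaryConj U A)ᴴ * unitaryConj U A) = Unitary.conjStarAlgAut ℝ _ U (Aᴴ * A) := by
    have h : (U : Matrix n n ℂ)ᴴ * (U : Matrix n n ℂ) = 1 := Unitary.coe_star_mul_self U
    rw [Unitary.conjStarAlgAut_apply, unitaryConj_apply]
    simp only [Matrix.conjTranspose_mul, Matrix.conjTranspose_conjTranspose, Matrix.mul_assoc]
    rw [← Matrix.mul_assoc (U : Matrix n n ℂ)ᴴ (U : Matrix n n ℂ), h, Matrix.one_mul]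
    rfl
  rw [schattenNorm, schattenNorm, tracePow, tracePow, h1]
  have hcont : Continuous (Unitary.conjStarAlgAut ℝ (Matrix n n ℂ) U) := by
    simp only [funext (Unitary.conjStarAlgAut_apply (S := ℝ) U)]
    fun_prop
  have hsa : IsSelfAdjoint (Aᴴ * A) := IsSelfAdjoint.star_mul_self A
  rw [← StarAlgHomClass.map_cfc (Unitary.conjStarAlgAut ℝ (Matrix n n ℂ) U)
    (fun x : ℝ => x ^ (p / 2)) (Aᴴ * A)
    (by exact (Real.continuous_rpow_const (by positivity)).continuousOn) hcont hsa
    (hsa.map _), Unitary.conjStarAlgAut_apply]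
  congr 2
  exact (congrArg Matrix.trace (unitaryConj_apply U _).symm).trans (trace_unitaryConj U _)

theorem maxNorm_unitaryConj_comp {n : Type*} [Fintype n] [DecidableEq n] {p : ℝ} (hp : 0 ≤ p)
    (U V : Matrix.unitaryGroup n ℂ) (Φ : Matrix n n ℂ →ₗ[ℂ] Matrix n n ℂ) :
    maxNorm p (unitaryConj U ∘ₗ Φ ∘ₗ unitaryConj V) = maxNorm p Φ := by
  unfold maxNorm
  congr 1
  ext x
  simp only [LinearMap.comp_apply, schattenNorm_unitaryConj hp, Set.mem_image, Set.mem_ofPred_eq]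
  constructor
  · rintro ⟨ρ, hρ, rfl⟩
    exact ⟨_, isState_unitaryConj V hρ, rfl⟩
  · rintro ⟨ρ, hρ, rfl⟩
    refine ⟨_, isState_unitaryConj V⁻¹ hρ, ?_⟩
    rw [← LinearMap.comp_apply (unitaryConj V), unitaryConj_comp, mul_inv_cancel,
      unitaryConj_one, LinearMap.id_apply]

theorem tensorMap_unitaryConj_comp {m n : Type*} [Fintype m] [DecidableEq m] [Fintype n]
    [DecidableEq n] (Ω : Matrix m m ℂ →ₗ[ℂ] Matrix m m ℂ)
    (Φ : Matrix n n ℂ →ₗ[ℂ] Matrix n n ℂ) (U V : Matrix.unitaryGroup n ℂ) :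
    ∃ U' V' : Matrix.unitaryGroup (m × n) ℂ,
      tensorMap Ω (unitaryConj U ∘ₗ Φ ∘ₗ unitaryConj V)
        = unitaryConj U' ∘ₗ tensorMap Ω Φ ∘ₗ unitaryConj V' := by
  have key : ∀ W : Matrix.unitaryGroup n ℂ, ∃ W' : Matrix.unitaryGroup (m × n) ℂ,
      ∀ (A : Matrix m m ℂ) (B : Matrix n n ℂ),
        unitaryConj W' (A ⊗ₖ B) = A ⊗ₖ unitaryConj W B := by
    intro W
    refine ⟨⟨1 ⊗ₖ (W : Matrix n n ℂ), Matrix.kronecker_mem_unitary (one_mem _) W.2⟩, fun A B => ?_⟩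
    rw [unitaryConj_apply, unitaryConj_apply, Matrix.conjTranspose_kronecker,
      ← Matrix.mul_kronecker_mul, ← Matrix.mul_kronecker_mul]
    simp
  obtain ⟨U', hU⟩ := key U
  obtain ⟨V', hV⟩ := key V
  refine ⟨U', V', linearMap_ext_kronecker fun A B => ?_⟩
  simp only [LinearMap.comp_apply, hV, hU, tensorMap_kronecker]

theorem IsChannel.unitaryConj_comp {n : Type*} [Fintype n] [DecidableEq n]
    {Φ : Matrix n n ℂ →ₗ[ℂ] Matrix n n ℂ} (hΦ : IsChannel Φ) (U V : Matrix.unitaryGroup n ℂ) :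
    IsChannel (unitaryConj U ∘ₗ Φ ∘ₗ unitaryConj V) where
  completelyPositive k M hM := by
    obtain ⟨U', V', h⟩ := tensorMap_unitaryConj_comp
      (LinearMap.id : Matrix (Fin k) (Fin k) ℂ →ₗ[ℂ] _) Φ U V
    rw [h]
    exact posSemidef_unitaryConj U' (hΦ.completelyPositive k _ (posSemidef_unitaryConj V' hM))
  tracePreserving A := by
    simp only [LinearMap.comp_apply, trace_unitaryConj, hΦ.tracePreserving]

/-! ### Hölder's inequality for the blocks of a positive matrix -/

/-- Padding square matrices with zeros to a larger size is multiplicative but not unital, hence the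
exclusion of the empty product. -/
theorem trace_prod_map_fromBlocks {m n β : Type*} [Fintype m] [DecidableEq m] [Fintype n]
    [DecidableEq n] (f : β → Matrix n n ℂ) {l : List β} (hl : l ≠ []) :
    ((l.map fun x => Matrix.fromBlocks (0 : Matrix m m ℂ) 0 0 (f x)).prod).trace
      = ((l.map f).prod).trace := by
  have key : (l.map fun x => Matrix.fromBlocks (0 : Matrix m m ℂ) 0 0 (f x)).prod
      = Matrix.fromBlocks 0 0 0 (l.map f).prod := by
    induction l with
    | nil => exact absurd rfl hl
    | cons x l ih =>
      rcases eq_or_ne l [] with rfl | h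
      · simp
      · simp [ih h, Matrix.fromBlocks_multiply]
  rw [key]
  simp [Matrix.trace]

/-- Writing `R = Dᴴ D`, the block `R_ij` is `C_iᴴ C_j` for the block columns `C_i` of `D`. A product
of `p` blocks is a word of `2 * p` letters, and the diagonal blocks `C_iᴴ C_i` bound the letters. -/
theorem norm_trace_prod_blocks_le {κ n : Type*} [Fintype κ] [DecidableEq κ] [Fintype n]
    [DecidableEq n] {R : Matrix (κ × n) (κ × n) ℂ} (hR : R.PosSemidef) {p : ℕ} (hp : 1 ≤ p)
    {b : κ → ℝ} (hb : ∀ i, 0 ≤ b i)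
    (h : ∀ i, ‖((R.submatrix (Prod.mk i) (Prod.mk i)) ^ p).trace‖ ≤ b i ^ (2 * p))
    {L : List (κ × κ)} (hL : L.length = p) :
    ‖((L.map fun x => R.submatrix (Prod.mk x.1) (Prod.mk x.2)).prod).trace‖
      ≤ (L.map fun x => b x.1 * b x.2).prod := by
  open scoped MatrixOrder in
    obtain ⟨D, rfl⟩ := CStarAlgebra.nonneg_iff_eq_star_mul_self.1 hR.nonneg
  rw [Matrix.star_eq_conjTranspose] at h ⊢
  set C : κ → Matrix (κ × n) n ℂ := fun i => D.submatrix id (Prod.mk i) with hC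
  have hblock : ∀ i j, (Dᴴ * D).submatrix (Prod.mk i) (Prod.mk j) = (C i)ᴴ * C j := by
    intro i j
    ext x y
    simp [hC, Matrix.mul_apply]
  simp only [hblock] at h ⊢
  -- The letters `(i, false)` and `(i, true)` stand for `C i` and its adjoint, padded with zeros
  -- to square matrices.
  let X : κ × Bool → Matrix ((κ × n) ⊕ n) ((κ × n) ⊕ n) ℂ := fun a =>
    bif a.2 then Matrix.fromBlocks 0 0 (C a.1)ᴴ 0 else Matrix.fromBlocks 0 (C a.1) 0 0
  have hX : ∀ a, X (a.1, !a.2) = (X a)ᴴ := by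
    rintro ⟨i, _ | _⟩ <;> simp [X, Matrix.fromBlocks_conjTranspose]
  have hmul : ∀ i j, X (i, true) * X (j, false) = Matrix.fromBlocks 0 0 0 ((C i)ᴴ * C j) := by
    intro i j
    simp [X, Matrix.fromBlocks_multiply]
  have htr : ∀ i, ((X (i, true) * X (i, false)) ^ p).trace = (((C i)ᴴ * C i) ^ p).trace := by
    intro i
    have := trace_prod_map_fromBlocks (m := κ × n) (fun _ : Unit => (C i)ᴴ * C i)
      (l := List.replicate p ()) (by simp; omega)
    simpa [hmul] using this
  have hbd : ∀ a, ‖((X a * (X a)ᴴ) ^ p).trace‖ ≤ b a.1 ^ (2 * p) := by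
    rintro ⟨i, _ | _⟩
    · obtain ⟨q, rfl⟩ : ∃ q, p = q + 1 := ⟨p - 1, by omega⟩
      rw [← hX, pow_succ, ← Matrix.mul_assoc, mul_pow_mul, Matrix.mul_assoc,
        Matrix.trace_mul_comm, Matrix.mul_assoc, ← pow_succ]
      exact (htr i).symm ▸ h i
    · rw [← hX]
      exact (htr i).symm ▸ h i
  have hlen : (L.flatMap fun x => [(x.1, true), (x.2, false)]).length = 2 * p := by
    simp [List.length_flatMap, hL, mul_comm]
  have hmain := norm_trace_word_le X hX (fun a => by simp) hp (fun a => hb a.1)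
    (fun a => rfl) hbd hlen
  have hne : L ≠ [] := by
    rintro rfl
    simp at hL
    omega
  have e1 : ((L.flatMap fun x => [(x.1, true), (x.2, false)]).map X).prod
      = (L.map fun x => Matrix.fromBlocks 0 0 0 ((C x.1)ᴴ * C x.2)).prod := by
    clear hL hlen hmain hne
    induction L with
    | nil => simp
    | cons x L ih => simp [ih, ← hmul, Matrix.mul_assoc]
  have e2 : ((L.flatMap fun x => [(x.1, true), (x.2, false)]).map fun a => b a.1).prod
      = (L.map fun x => b x.1 * b x.2).prod := by
    clear hL hlen hmain hne e1
    induction L with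
    | nil => simp
    | cons x L ih => simp [ih, mul_assoc]
  rwa [e1, e2, trace_prod_map_fromBlocks _ hne] at hmain

/-! ### Tensor products with an entrywise positive channel -/

theorem sum_pow_eq_sum_prod_ofFn {A β : Type*} [Semiring A] [Fintype β] (f : β → A) (p : ℕ) :
    (∑ x, f x) ^ p = ∑ w : Fin p → β, ((List.ofFn w).map f).prod := by
  induction p with
  | zero => simp
  | succ p ih =>
    rw [pow_succ', ih, Finset.sum_mul_sum, ← (Fin.consEquiv fun _ => β).sum_comp,
      Fintype.sum_prod_type]
    simp [Fin.consEquiv, List.ofFn_succ]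

theorem prod_map_kronecker {m n β : Type*} [Fintype m] [DecidableEq m] [Fintype n]
    [DecidableEq n] (f : β → Matrix m m ℂ) (g : β → Matrix n n ℂ) (l : List β) :
    (l.map fun x => f x ⊗ₖ g x).prod = (l.map f).prod ⊗ₖ (l.map g).prod := by
  induction l with
  | nil => simp
  | cons x l ih => simp [ih, Matrix.mul_kronecker_mul]

theorem prod_map_smul {A β : Type*} [Ring A] [Algebra ℂ A] (c : β → ℂ) (f : β → A) (l : List β) :
    (l.map fun x => c x • f x).prod = (l.map c).prod • (l.map f).prod := by
  induction l with
  | nil => simp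
  | cons x l ih =>
    simp only [List.map_cons, List.prod_cons]
    rw [ih, smul_mul_smul_comm]

theorem prod_map_apply_nonneg {n β : Type*} [Fintype n] [DecidableEq n] (f : β → Matrix n n ℂ)
    (hf : ∀ x i j, 0 ≤ f x i j) (l : List β) (i j : n) : 0 ≤ (l.map f).prod i j := by
  induction l generalizing i with
  | nil =>
    rw [List.map_nil, List.prod_nil, Matrix.one_apply]
    split_ifs <;> simp
  | cons x l ih =>
    rw [List.map_cons, List.prod_cons, Matrix.mul_apply]
    exact Finset.sum_nonneg fun k _ => mul_nonneg (hf x i k) (ih k)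

/-- Since `Φ` maps matrix units to matrices with nonnegative entries, expanding the trace of the
`p`-th power gives nonnegative coefficients, so Hölder's inequality may be applied term by term;
the resulting sum is the trace of the `p`-th power of `Φ` at the rank-one matrix `b bᵀ`. -/
theorem norm_trace_tensorMap_pow_le {m κ : Type*} [Fintype m] [DecidableEq m] [Fintype κ]
    [DecidableEq κ] {Ω : Matrix m m ℂ →ₗ[ℂ] Matrix m m ℂ} (hΩ : IsChannel Ω)
    {Φ : Matrix κ κ ℂ →ₗ[ℂ] Matrix κ κ ℂ} (hΦ : IsChannel Φ)
    (hpos : ∀ i j k l, 0 ≤ Φ (Matrix.single i j 1) k l) {p : ℕ} (hp : 1 ≤ p)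
    {M : Matrix (m × κ) (m × κ) ℂ} (hM : IsState M) :
    ‖((tensorMap Ω Φ M) ^ p).trace‖ ≤ (maxNorm (p : ℝ) Ω * maxNorm (p : ℝ) Φ) ^ p := by
  set ν := maxNorm (p : ℝ) Ω with hν
  have hν0 : 0 ≤ ν := maxNorm_nonneg hΩ p
  have hMi : ∀ i : κ, (M.submatrix (·, i) (·, i)).PosSemidef := fun i => hM.1.submatrix _
  set τ : κ → ℝ := fun i => (M.submatrix (·, i) (·, i)).trace.re with hτ
  have hτ0 : ∀ i, 0 ≤ τ i := fun i => by
    rw [hτ]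
    simp only
    rw [← norm_trace_eq_re (hMi i)]
    exact norm_nonneg _
  have hτ1 : ∑ i, τ i = 1 := by
    have := congrArg Complex.re hM.2
    rw [Complex.one_re, Matrix.trace, Fintype.sum_prod_type_right, Complex.re_sum] at this
    exact this
  set R := tensorMap (LinearMap.id : Matrix κ κ ℂ →ₗ[ℂ] _) Ω (M.submatrix Prod.swap Prod.swap)
    with hRd
  have hR : R.PosSemidef := hΩ.posSemidef_tensorMap_id (hM.1.submatrix _)
  have hblock : ∀ i j, R.submatrix (Prod.mk i) (Prod.mk j) = Ω (M.submatrix (·, i) (·, j)) := by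
    intro i j
    ext x y
    rw [Matrix.submatrix_apply, hRd, tensorMap_id_apply]
    rfl
  set b : κ → ℝ := fun i => √(ν * τ i) with hb
  have hb0 : ∀ i, 0 ≤ b i := fun i => Real.sqrt_nonneg _
  have hb2 : ∀ i, b i ^ 2 = ν * τ i := fun i => Real.sq_sqrt (mul_nonneg hν0 (hτ0 i))
  have hbd : ∀ i, ‖((R.submatrix (Prod.mk i) (Prod.mk i)) ^ p).trace‖ ≤ b i ^ (2 * p) := by
    intro i
    rw [hblock, pow_mul, hb2]
    exact hΩ.norm_trace_pow_le hp (hMi i)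
  set E : κ × κ → Matrix κ κ ℂ := fun x => Φ (Matrix.single x.1 x.2 1) with hE
  set B : κ × κ → ℝ := fun x => b x.1 * b x.2 with hB
  have hEn : ∀ w : List (κ × κ), 0 ≤ ((w.map E).prod).trace := fun w =>
    Finset.sum_nonneg fun i _ => prod_map_apply_nonneg E (fun x => hpos _ _) w i i
  -- the rank-one matrix with entries `b i * b j`
  set N : Matrix κ κ ℂ := Matrix.vecMulVec (fun i => (b i : ℂ)) (star fun i => (b i : ℂ)) with hN
  have hNp : N.PosSemidef := Matrix.posSemidef_vecMulVec_self_star _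
  have hNe : ∀ x : κ × κ, N x.1 x.2 = ((B x : ℝ) : ℂ) := fun x => by
    simp [hN, hB, Matrix.vecMulVec_apply]
  have hNt : N.trace.re = ν := by
    have : N.trace = ((∑ i, ν * τ i : ℝ) : ℂ) := by
      rw [Matrix.trace, Complex.ofReal_sum]
      refine Finset.sum_congr rfl fun i _ => ?_
      rw [Matrix.diag_apply, hNe (i, i), ← hb2, sq]
    rw [this, Complex.ofReal_re, ← Finset.mul_sum, hτ1, mul_one]
  have hΦN : ((Φ N) ^ p).trace
      = ((∑ w : Fin p → κ × κ, ((List.ofFn w).map B).prod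
          * ‖(((List.ofFn w).map E).prod).trace‖ : ℝ) : ℂ) := by
    rw [map_eq_sum_single, sum_pow_eq_sum_prod_ofFn, Matrix.trace_sum, Complex.ofReal_sum]
    refine Finset.sum_congr rfl fun w _ => ?_
    rw [prod_map_smul, Matrix.trace_smul, Complex.ofReal_mul, Complex.norm_of_nonneg' (hEn _),
      smul_eq_mul]
    congr 1
    rw [← Complex.ofRealHom_eq_coe, map_list_prod, List.map_map]
    congr 2
    funext x
    exact hNe x
  calc ‖((tensorMap Ω Φ M) ^ p).trace‖
      = ‖∑ w : Fin p → κ × κ,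
          (((List.ofFn w).map fun x => R.submatrix (Prod.mk x.1) (Prod.mk x.2)).prod).trace
            * (((List.ofFn w).map E).prod).trace‖ := by
        rw [tensorMap_apply, sum_pow_eq_sum_prod_ofFn, Matrix.trace_sum]
        congr 1
        refine Finset.sum_congr rfl fun w _ => ?_
        rw [prod_map_kronecker, Matrix.trace_kronecker]
        simp only [hblock, hE]
    _ ≤ ∑ w : Fin p → κ × κ, ((List.ofFn w).map B).prod
          * ‖(((List.ofFn w).map E).prod).trace‖ := by
        refine (norm_sum_le _ _).trans (Finset.sum_le_sum fun w _ => ?_)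
        rw [norm_mul]
        exact mul_le_mul_of_nonneg_right
          (norm_trace_prod_blocks_le hR hp hb0 hbd (List.length_ofFn)) (norm_nonneg _)
    _ ≤ ‖((Φ N) ^ p).trace‖ := by
        rw [hΦN, Complex.norm_real]
        exact le_abs_self _
    _ ≤ (maxNorm (p : ℝ) Φ * N.trace.re) ^ p := hΦ.norm_trace_pow_le hp hNp
    _ = _ := by rw [hNt, mul_comm]

theorem isState_kronecker {m n : Type*} [Fintype m] [DecidableEq m] [Fintype n] [DecidableEq n]
    {ρ : Matrix m m ℂ} {σ : Matrix n n ℂ} (hρ : IsState ρ) (hσ : IsState σ) :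
    IsState (ρ ⊗ₖ σ) :=
  ⟨hρ.1.kronecker hσ.1, by rw [Matrix.trace_kronecker, hρ.2, hσ.2, one_mul]⟩

theorem isState_single {n : Type*} [Fintype n] [DecidableEq n] (i : n) :
    IsState (Matrix.single i i (1 : ℂ)) := by
  have h : Matrix.single i i (1 : ℂ) = Matrix.vecMulVec (Pi.single i 1) (star (Pi.single i 1)) := by
    ext j k
    simp only [Matrix.single_apply, Matrix.vecMulVec_apply, Pi.single_apply, Pi.star_apply]
    split_ifs <;> simp_all
  exact ⟨h ▸ Matrix.posSemidef_vecMulVec_self_star _, by simp⟩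

/-- The maximal norm is multiplicative for a channel that maps matrix units to matrices with
nonnegative entries: `norm_trace_tensorMap_pow_le` bounds it above, product states bound it below. -/
theorem maxNorm_tensorMap_of_entrywise_nonneg {m κ : Type*} [Fintype m] [DecidableEq m]
    [Nonempty m] [Fintype κ] [DecidableEq κ] [Nonempty κ]
    {Ω : Matrix m m ℂ →ₗ[ℂ] Matrix m m ℂ} (hΩ : IsChannel Ω)
    {Φ : Matrix κ κ ℂ →ₗ[ℂ] Matrix κ κ ℂ} (hΦ : IsChannel Φ)
    (hpos : ∀ i j k l, 0 ≤ Φ (Matrix.single i j 1) k l) {p : ℕ} (hp : 1 ≤ p) :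
    maxNorm (p : ℝ) (tensorMap Ω Φ) = maxNorm (p : ℝ) Ω * maxNorm (p : ℝ) Φ := by
  have hK : 0 ≤ maxNorm (p : ℝ) Ω * maxNorm (p : ℝ) Φ :=
    mul_nonneg (maxNorm_nonneg hΩ p) (maxNorm_nonneg hΦ p)
  have hle : ∀ M, IsState M → schattenNorm (p : ℝ) (tensorMap Ω Φ M)
      ≤ maxNorm (p : ℝ) Ω * maxNorm (p : ℝ) Φ := by
    intro M hM
    have hT := posSemidef_tensorMap hΩ hΦ hM.1
    rw [← pow_le_pow_iff_left₀ (schattenNorm_nonneg hT p) hK (by omega : p ≠ 0),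
      schattenNorm_pow hT hp]
    exact norm_trace_tensorMap_pow_le hΩ hΦ hpos hp hM
  have hρ₀ := isState_single (Classical.arbitrary m)
  have hσ₀ := isState_single (Classical.arbitrary κ)
  refine le_antisymm (csSup_le ⟨_, _, isState_kronecker hρ₀ hσ₀, rfl⟩ ?_) ?_
  · rintro _ ⟨M, hM, rfl⟩
    exact hle M hM
  have hprod : ∀ ρ σ, IsState ρ → IsState σ → schattenNorm (p : ℝ) (Ω ρ)
      * schattenNorm (p : ℝ) (Φ σ) ≤ maxNorm (p : ℝ) (tensorMap Ω Φ) := by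
    intro ρ σ hρ hσ
    rw [← schattenNorm_kronecker (hΩ.isState hρ).1 (hΦ.isState hσ).1 hp, ← tensorMap_kronecker]
    refine le_csSup ⟨maxNorm (p : ℝ) Ω * maxNorm (p : ℝ) Φ, ?_⟩
      ⟨_, isState_kronecker hρ hσ, rfl⟩
    rintro _ ⟨M, hM, rfl⟩
    exact hle M hM
  have hT0 : 0 ≤ maxNorm (p : ℝ) (tensorMap Ω Φ) := (mul_nonneg
    (schattenNorm_nonneg (hΩ.isState hρ₀).1 p) (schattenNorm_nonneg (hΦ.isState hσ₀).1 p)).trans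
    (hprod _ _ hρ₀ hσ₀)
  have hΩσ : ∀ σ, IsState σ → maxNorm (p : ℝ) Ω * schattenNorm (p : ℝ) (Φ σ)
      ≤ maxNorm (p : ℝ) (tensorMap Ω Φ) := by
    intro σ hσ
    rcases (schattenNorm_nonneg (hΦ.isState hσ).1 p).eq_or_lt with h0 | h0
    · rwa [← h0, mul_zero]
    · rw [← le_div_iff₀ h0]
      refine csSup_le ⟨_, _, hρ₀, rfl⟩ ?_
      rintro _ ⟨ρ, hρ, rfl⟩
      exact (le_div_iff₀ h0).2 (hprod ρ σ hρ hσ)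
  rcases (maxNorm_nonneg hΩ p).eq_or_lt with h0 | h0
  · rwa [← h0, zero_mul]
  · rw [← le_div_iff₀' h0]
    refine csSup_le ⟨_, _, hσ₀, rfl⟩ ?_
    rintro _ ⟨σ, hσ, rfl⟩
    exact (le_div_iff₀' h0).2 (hΩσ σ hσ)

/-! ### Qubit channels in entrywise positive form -/

theorem exists_sign_mul_eq_abs (x : ℝ) : ∃ s : ℝ, s * s = 1 ∧ s * x = |x| := by
  rcases le_total 0 x with h | h
  · exact ⟨1, by norm_num, by rw [abs_of_nonneg h, one_mul]⟩
  · exact ⟨-1, by norm_num, by rw [abs_of_nonpos h, neg_one_mul]⟩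

theorem exists_unit_mul_nonneg (z : ℂ) : ∃ u : ℂ, u * star u = 1 ∧ 0 ≤ u * z := by
  rcases eq_or_ne z 0 with rfl | hz
  · exact ⟨1, by simp, by simp⟩
  · have hn : (‖z‖ : ℂ) ≠ 0 := by simpa using hz
    refine ⟨star z / ‖z‖, ?_, ?_⟩
    · simp only [star_div₀, Complex.star_def, Complex.conj_conj, Complex.conj_ofReal]
      rw [div_mul_div_comm, Complex.conj_mul', ← sq, div_self (pow_ne_zero _ hn)]
    · rw [div_mul_eq_mul_div, Complex.star_def, Complex.conj_mul', sq, mul_div_assoc,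
        div_self hn, mul_one]
      exact_mod_cast norm_nonneg z

/-- The phases of the diagonal unitaries that make all entries nonnegative. If `|a| = |b|`, one of
the two last conditions is void and the phase `u` is free to rotate `c + i d`; otherwise `c + i d`
must be real or imaginary already, and only signs can be corrected. -/
theorem exists_phases {a b c d : ℝ}
    (h : |a| = |b| ∨ (d = 0 ∧ |b| ≤ |a|) ∨ (c = 0 ∧ |a| ≤ |b|)) :
    ∃ u v : ℂ, u * star u = 1 ∧ v * star v = 1 ∧ 0 ≤ u * (c + Complex.I * d) ∧
      0 ≤ (a + b) * (star u * star v) ∧ 0 ≤ (a - b) * (u * star v) := by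
  rcases h with h | ⟨rfl, h⟩ | ⟨rfl, h⟩
  · obtain ⟨u, hu, hu0⟩ := exists_unit_mul_nonneg (c + Complex.I * d)
    obtain ⟨s, hs, hsa⟩ := exists_sign_mul_eq_abs a
    have hs' : (s : ℂ) * s = 1 := by exact_mod_cast hs
    have hsa' : (s : ℂ) * a = (|a| : ℝ) := by exact_mod_cast hsa
    have habs : (0 : ℂ) ≤ 2 * (|a| : ℝ) := by
      have : (0 : ℝ) ≤ 2 * |a| := by positivity
      exact_mod_cast this
    have hss : star (s : ℂ) = s := Complex.conj_ofReal s
    rcases abs_eq_abs.1 h with rfl | h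
    · refine ⟨u, s * star u, hu, ?_, hu0, ?_, ?_⟩
      · rw [star_mul', star_star, hss]
        linear_combination u * star u * hs' + hu
      · rw [star_mul', star_star, hss]
        convert habs using 1
        linear_combination 2 * a * s * hu + 2 * hsa'
      · rw [sub_self, zero_mul]
    · obtain rfl : b = -a := by linarith
      refine ⟨u, s * u, hu, ?_, hu0, ?_, ?_⟩
      · rw [star_mul', hss]
        linear_combination u * star u * hs' + hu
      · rw [Complex.ofReal_neg, add_neg_cancel, zero_mul]
      · rw [star_mul', hss]
        convert habs using 1
        push_cast
        linear_combination 2 * a * s * hu + 2 * hsa'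
  · obtain ⟨r, hr, hrc⟩ := exists_sign_mul_eq_abs c
    obtain ⟨s, hs, hsa⟩ := exists_sign_mul_eq_abs a
    have h1 : 0 ≤ (a + b) * s := by
      have : |b * s| ≤ |a * s| := by rw [abs_mul, abs_mul]; gcongr
      rw [mul_comm a s, hsa, abs_abs, ← hsa] at this
      linarith [abs_le.1 this]
    have h2 : 0 ≤ (a - b) * s := by
      have : |b * s| ≤ |a * s| := by rw [abs_mul, abs_mul]; gcongr
      rw [mul_comm a s, hsa, abs_abs, ← hsa] at this
      linarith [abs_le.1 this]
    have e1 : (a + b) * (r * (r * s)) = (a + b) * s := by linear_combination (a + b) * s * hr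
    have e2 : (a - b) * (r * (r * s)) = (a - b) * s := by linear_combination (a - b) * s * hr
    refine ⟨r, ((r * s : ℝ) : ℂ), ?_, ?_, ?_, ?_, ?_⟩ <;>
      simp only [Complex.star_def, Complex.conj_ofReal, Complex.ofReal_zero, mul_zero, add_zero]
    · exact_mod_cast hr
    · have : r * s * (r * s) = 1 := by linear_combination s * s * hr + hs
      exact_mod_cast this
    · have : 0 ≤ r * c := hrc ▸ abs_nonneg c
      exact_mod_cast this
    · exact_mod_cast e1 ▸ h1
    · exact_mod_cast e2 ▸ h2
  · obtain ⟨r, hr, hrd⟩ := exists_sign_mul_eq_abs d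
    obtain ⟨s, hs, hsb⟩ := exists_sign_mul_eq_abs b
    have h1 : |a * s| ≤ |b * s| := by rw [abs_mul, abs_mul]; gcongr
    rw [mul_comm b s, hsb, abs_abs, ← hsb] at h1
    have hs' : (s : ℂ) * s = 1 := by exact_mod_cast hs
    have hr' : (r : ℂ) * r = 1 := by exact_mod_cast hr
    refine ⟨-Complex.I * r, Complex.I * (r * s : ℝ), ?_, ?_, ?_, ?_, ?_⟩ <;>
      simp only [Complex.star_def, map_mul, map_neg, Complex.conj_ofReal, Complex.conj_I,
        Complex.ofReal_zero, zero_add, Complex.ofReal_mul]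
    · linear_combination hr' - r * r * Complex.I_sq
    · linear_combination s * s * hr' + hs' - r * r * s * s * Complex.I_sq
    · have : 0 ≤ r * d := hrd ▸ abs_nonneg d
      have e : -Complex.I * r * (Complex.I * d) = ((r * d : ℝ) : ℂ) := by
        push_cast
        linear_combination -r * d * Complex.I_sq
      rw [e]
      exact_mod_cast this
    · have : 0 ≤ (a + b) * s := by linarith [abs_le.1 h1]
      have e : ((a : ℂ) + b) * (- -Complex.I * r * (-Complex.I * (r * s)))
          = (((a + b) * s : ℝ) : ℂ) := by
        push_cast
        linear_combination (a + b) * s * hr' - (a + b) * s * r * r * Complex.I_sq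
      rw [e]
      exact_mod_cast this
    · have : 0 ≤ (b - a) * s := by linarith [abs_le.1 h1]
      have e : ((a : ℂ) - b) * (-Complex.I * r * (-Complex.I * (r * s)))
          = (((b - a) * s : ℝ) : ℂ) := by
        push_cast
        linear_combination (b - a) * s * hr' + (a - b) * s * r * r * Complex.I_sq
      rw [e]
      exact_mod_cast this

/-- The diagonal unitary with entries `1` and `u`. -/
def phaseUnitary (u : ℂ) (hu : u * star u = 1) : Matrix.unitaryGroup (Fin 2) ℂ :=
  ⟨!![1, 0; 0, u], by
    rw [Matrix.mem_unitaryGroup_iff]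
    ext i j
    fin_cases i <;> fin_cases j <;> simp [Matrix.mul_apply, Matrix.star_apply]
    simpa using hu⟩

theorem unitaryConj_phaseUnitary (u : ℂ) (hu : u * star u = 1) (A : Matrix (Fin 2) (Fin 2) ℂ) :
    unitaryConj (phaseUnitary u hu) A = !![A 0 0, A 0 1 * star u; u * A 1 0, A 1 1] := by
  rw [unitaryConj_apply]
  have hu' : u * (starRingEnd ℂ) u = 1 := hu
  have hmul : ∀ x : ℂ, u * x * (starRingEnd ℂ) u = x := fun x => by
    rw [mul_right_comm, hu', one_mul]
  rw [Matrix.eta_fin_two A]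
  ext i j
  fin_cases i <;> fin_cases j <;>
    simp [phaseUnitary, Matrix.mul_apply, Fin.sum_univ_two, hmul]

/-- Diagonal unitaries in the domain and the range multiply the images of the matrix units by
phases. The diagonal entries of `Φ (single i i 1)` are nonnegative because `Φ` is positive, and its
off-diagonal entries are `(t 0 ± i t 1) / 2`; the nonzero entries of the images of the two other
matrix units are `(lam 0 ± lam 1) / 2`. -/
theorem IsNormalForm.exists_entrywise_nonneg {Φ : Matrix (Fin 2) (Fin 2) ℂ →ₗ[ℂ] _}
    (hΦ : IsChannel Φ) {lam t : Fin 3 → ℝ} (hf : IsNormalForm Φ lam t)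
    (h : |lam 0| = |lam 1| ∨ (t 1 = 0 ∧ |lam 1| ≤ |lam 0|) ∨ (t 0 = 0 ∧ |lam 0| ≤ |lam 1|)) :
    ∃ U V : Matrix.unitaryGroup (Fin 2) ℂ,
      ∀ i j k l, 0 ≤ (unitaryConj U ∘ₗ Φ ∘ₗ unitaryConj V) (Matrix.single i j 1) k l := by
  obtain ⟨u, v, hu, hv, h1, h2, h3⟩ := exists_phases h
  refine ⟨phaseUnitary u hu, phaseUnitary v hv, ?_⟩
  set U := phaseUnitary u hu with hU
  set V := phaseUnitary v hv with hV
  have half : (0 : ℂ) ≤ 1 / 2 := by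
    rw [Complex.nonneg_iff]
    norm_num
  have hdiag : ∀ i k, 0 ≤ (unitaryConj U ∘ₗ Φ ∘ₗ unitaryConj V) (Matrix.single i i 1) k k :=
    fun i k => ((hΦ.unitaryConj_comp U V).isState (isState_single i)).1.diag_nonneg
  have s00 : Matrix.single 0 0 (1 : ℂ) = (1 / 2 : ℂ) • (1 + pauli 2) := by
    ext i j
    fin_cases i <;> fin_cases j <;> simp [pauli]; norm_num
  have s11 : Matrix.single 1 1 (1 : ℂ) = (1 / 2 : ℂ) • (1 - pauli 2) := by
    ext i j
    fin_cases i <;> fin_cases j <;> simp [pauli]; norm_num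
  have s01 : Matrix.single 0 1 (1 : ℂ) = (1 / 2 : ℂ) • (pauli 0 + Complex.I • pauli 1) := by
    ext i j
    fin_cases i <;> fin_cases j <;> simp [pauli]; norm_num
  have s10 : Matrix.single 1 0 (1 : ℂ) = (1 / 2 : ℂ) • (pauli 0 - Complex.I • pauli 1) := by
    ext i j
    fin_cases i <;> fin_cases j <;> simp [pauli]; norm_num
  have h1' := star_nonneg_iff.2 h1
  have h2' := star_nonneg_iff.2 h2
  have h3' := star_nonneg_iff.2 h3
  have v00 : unitaryConj V (Matrix.single 0 0 1) = Matrix.single 0 0 1 := by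
    rw [hV, unitaryConj_phaseUnitary]
    ext i j
    fin_cases i <;> fin_cases j <;> simp
  have v11 : unitaryConj V (Matrix.single 1 1 1) = Matrix.single 1 1 1 := by
    rw [hV, unitaryConj_phaseUnitary]
    ext i j
    fin_cases i <;> fin_cases j <;> simp
  have v01 : unitaryConj V (Matrix.single 0 1 1) = star v • Matrix.single 0 1 1 := by
    rw [hV, unitaryConj_phaseUnitary]
    ext i j
    fin_cases i <;> fin_cases j <;> simp
  have v10 : unitaryConj V (Matrix.single 1 0 1) = v • Matrix.single 1 0 1 := by
    rw [hV, unitaryConj_phaseUnitary]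
    ext i j
    fin_cases i <;> fin_cases j <;> simp
  have hoff : ∀ i, 0 ≤ (unitaryConj U ∘ₗ Φ ∘ₗ unitaryConj V) (Matrix.single i i 1) 0 1 ∧
      0 ≤ (unitaryConj U ∘ₗ Φ ∘ₗ unitaryConj V) (Matrix.single i i 1) 1 0 := by
    have a1 := mul_nonneg half h1
    have a2 := mul_nonneg half h1'
    intro i
    fin_cases i
    · simp only [Fin.zero_eta, LinearMap.comp_apply]
      rw [v00, s00, map_smul, map_add, hf.map_one, hf.map_pauli, hU, unitaryConj_phaseUnitary]
      constructor
      · convert a2 using 1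
        simp [pauli, Fin.sum_univ_three]
        ring
      · convert a1 using 1
        simp [pauli, Fin.sum_univ_three]
        ring
    · simp only [Fin.mk_one, LinearMap.comp_apply]
      rw [v11, s11, map_smul, map_sub, hf.map_one, hf.map_pauli, hU, unitaryConj_phaseUnitary]
      constructor
      · convert a2 using 1
        simp [pauli, Fin.sum_univ_three]
        ring
      · convert a1 using 1
        simp [pauli, Fin.sum_univ_three]
        ring
  have e01 : (unitaryConj U ∘ₗ Φ ∘ₗ unitaryConj V) (Matrix.single 0 1 1)
      = !![0, 1 / 2 * ((lam 0 + lam 1) * (star u * star v));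
          1 / 2 * ((lam 0 - lam 1) * (u * star v)), 0] := by
    simp only [LinearMap.comp_apply]
    rw [v01, s01, hU]
    simp only [map_smul, map_add, hf.map_pauli, unitaryConj_phaseUnitary]
    ext i j
    fin_cases i <;> fin_cases j <;> simp [pauli]
    · linear_combination (-(1 / 2) * lam 1 * starRingEnd ℂ u * starRingEnd ℂ v : ℂ) * Complex.I_sq
    · linear_combination ((1 / 2) * lam 1 * u * starRingEnd ℂ v : ℂ) * Complex.I_sq
  have e10 : (unitaryConj U ∘ₗ Φ ∘ₗ unitaryConj V) (Matrix.single 1 0 1)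
      = !![0, 1 / 2 * star ((lam 0 - lam 1) * (u * star v));
          1 / 2 * star ((lam 0 + lam 1) * (star u * star v)), 0] := by
    simp only [LinearMap.comp_apply]
    rw [v10, s10, hU]
    simp only [map_smul, map_sub, hf.map_pauli, unitaryConj_phaseUnitary]
    ext i j
    fin_cases i <;> fin_cases j <;> simp [pauli]
    · linear_combination ((1 / 2) * lam 1 * starRingEnd ℂ u * v : ℂ) * Complex.I_sq
    · linear_combination (-(1 / 2) * lam 1 * u * v : ℂ) * Complex.I_sq
  intro i j k l
  fin_cases i <;> fin_cases j <;> simp only [Fin.zero_eta, Fin.mk_one]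
  · fin_cases k <;> fin_cases l
    exacts [hdiag _ _, (hoff _).1, (hoff _).2, hdiag _ _]
  · rw [e01]
    fin_cases k <;> fin_cases l
    exacts [le_rfl, mul_nonneg half h2, mul_nonneg half h3, le_rfl]
  · rw [e10]
    fin_cases k <;> fin_cases l
    exacts [le_rfl, mul_nonneg half h3', mul_nonneg half h2', le_rfl]
  · fin_cases k <;> fin_cases l
    exacts [hdiag _ _, (hoff _).1, (hoff _).2, hdiag _ _]

/-- The unitary `(1 - i (σ₁ + σ₂ + σ₃)) / 2`, a rotation by a third of a turn about `(1, 1, 1)`: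
its conjugation permutes the Pauli matrices cyclically. -/
def cyclicUnitary : Matrix.unitaryGroup (Fin 2) ℂ :=
  ⟨(1 / 2 : ℂ) • !![1 - Complex.I, -1 - Complex.I; 1 - Complex.I, 1 + Complex.I], by
    rw [Matrix.mem_unitaryGroup_iff]
    ext i j
    fin_cases i <;> fin_cases j <;>
      simp [Matrix.mul_apply, Matrix.star_apply] <;> ring_nf <;> simp [Complex.ext_iff] <;> norm_num⟩

theorem unitaryConj_cyclicUnitary_pauli (i : Fin 3) :
    unitaryConj cyclicUnitary (pauli i) = pauli (i + 1) := by
  rw [unitaryConj_apply]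
  ext k l
  fin_cases i <;> fin_cases k <;> fin_cases l <;>
    simp [cyclicUnitary, pauli, Matrix.mul_apply, Fin.sum_univ_two, Complex.ext_iff] <;> norm_num

/-- A cyclic relabelling of the axes permutes the parameters of the normal form. -/
theorem IsNormalForm.rotate {Φ : Matrix (Fin 2) (Fin 2) ℂ →ₗ[ℂ] _} {lam t : Fin 3 → ℝ}
    (hf : IsNormalForm Φ lam t) :
    IsNormalForm (unitaryConj cyclicUnitary⁻¹ ∘ₗ Φ ∘ₗ unitaryConj cyclicUnitary)
      (fun i => lam (i + 1)) (fun i => t (i + 1)) := by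
  have hinv : ∀ i, unitaryConj cyclicUnitary⁻¹ (pauli (i + 1)) = pauli i := fun i => by
    rw [← unitaryConj_cyclicUnitary_pauli, ← LinearMap.comp_apply, unitaryConj_comp,
      inv_mul_cancel, unitaryConj_one, LinearMap.id_apply]
  have hone : ∀ U : Matrix.unitaryGroup (Fin 2) ℂ, unitaryConj U 1 = 1 := fun U => by
    rw [unitaryConj_apply, Matrix.mul_one]
    exact Unitary.coe_mul_star_self U
  constructor
  · simp only [LinearMap.comp_apply]
    rw [hone, hf.map_one, ← Equiv.sum_comp (Equiv.addRight (1 : Fin 3))]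
    simp only [map_add, map_sum, map_smul, hone, Equiv.coe_addRight, hinv]
  · intro i
    simp only [LinearMap.comp_apply]
    rw [unitaryConj_cyclicUnitary_pauli, hf.map_pauli, map_smul, hinv]

/-- Some pair of axes can play the part of the first two in `IsNormalForm.exists_entrywise_nonneg`:
two axes with equal `|lam|` if there are any, and otherwise an axis with `t = 0` that is not the
longest, together with the longest one. -/
theorem exists_axes {lam t : Fin 3 → ℝ}
    (hcond : ∀ i j k : Fin 3, |lam i| < |lam j| → |lam j| < |lam k| → t i * t j = 0) :
    ∃ k : Fin 3, |lam k| = |lam (k + 1)| ∨ (t (k + 1) = 0 ∧ |lam (k + 1)| ≤ |lam k|) ∨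
      (t k = 0 ∧ |lam k| ≤ |lam (k + 1)|) := by
  by_contra! hcon
  have h0 := hcon 0
  have h1 := hcon 1
  have h2 := hcon 2
  have a1 := hcond 0 1 2
  have a2 := hcond 0 2 1
  have a3 := hcond 1 0 2
  have a4 := hcond 1 2 0
  have a5 := hcond 2 0 1
  have a6 := hcond 2 1 0
  simp only [mul_eq_zero, zero_add, show (1 : Fin 3) + 1 = 2 from rfl,
    show (2 : Fin 3) + 1 = 0 from rfl] at *
  grind

theorem HasNormalForm.exists_entrywise_nonneg {Φ : Matrix (Fin 2) (Fin 2) ℂ →ₗ[ℂ] _}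
    (hΦ : IsChannel Φ) {lam t : Fin 3 → ℝ} (hf : HasNormalForm Φ lam t)
    (hcond : ∀ i j k : Fin 3, |lam i| < |lam j| → |lam j| < |lam k| → t i * t j = 0) :
    ∃ U V : Matrix.unitaryGroup (Fin 2) ℂ,
      ∀ i j k l, 0 ≤ (unitaryConj U ∘ₗ Φ ∘ₗ unitaryConj V) (Matrix.single i j 1) k l := by
  have key : ∀ k : Fin 3, HasNormalForm Φ (fun i => lam (i + k)) (fun i => t (i + k)) := by
    have step : ∀ {lam t : Fin 3 → ℝ}, HasNormalForm Φ lam t →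
        HasNormalForm Φ (fun i => lam (i + 1)) (fun i => t (i + 1)) := by
      rintro lam t ⟨U, V, h⟩
      refine ⟨cyclicUnitary⁻¹ * U, V * cyclicUnitary, ?_⟩
      rw [← unitaryConj_comp, ← unitaryConj_comp]
      exact h.rotate
    intro k
    fin_cases k
    · simpa using hf
    · exact step hf
    · have := step (step hf)
      simp only [add_assoc] at this
      exact this
  obtain ⟨k, hk⟩ := exists_axes hcond
  -- rotate the axes `k` and `k + 1` to the first two places
  obtain ⟨U, V, h⟩ := key k
  obtain ⟨U', V', h'⟩ := h.exists_entrywise_nonneg (hΦ.unitaryConj_comp U V)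
    (by simpa only [zero_add, add_comm (1 : Fin 3)] using hk)
  refine ⟨U' * U, V * V', fun i j k l => ?_⟩
  rw [← unitaryConj_comp, ← unitaryConj_comp]
  exact h' i j k l

end

theorem theorem3
    (Φ : Matrix (Fin 2) (Fin 2) ℂ →ₗ[ℂ] Matrix (Fin 2) (Fin 2) ℂ) (hΦ : IsChannel Φ)
    (lam t : Fin 3 → ℝ) (hform : HasNormalForm Φ lam t)
    (hcond : ∀ i j k : Fin 3, |lam i| < |lam j| → |lam j| < |lam k| → t i * t j = 0)
    {n : Type*} [Fintype n] [DecidableEq n] [Nonempty n]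
    (Ω : Matrix n n ℂ →ₗ[ℂ] Matrix n n ℂ) (hΩ : IsChannel Ω)
    (p : ℕ) (hp : 1 ≤ p) :
    maxNorm (p : ℝ) (tensorMap Ω Φ) = maxNorm (p : ℝ) Ω * maxNorm (p : ℝ) Φ := by
  obtain ⟨U, V, hpos⟩ := hform.exists_entrywise_nonneg hΦ hcond
  obtain ⟨U', V', h⟩ := tensorMap_unitaryConj_comp Ω Φ U V
  have hmain := maxNorm_tensorMap_of_entrywise_nonneg hΩ (hΦ.unitaryConj_comp U V) hpos hp
  rwa [h, maxNorm_unitaryConj_comp (Nat.cast_nonneg p),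
    maxNorm_unitaryConj_comp (Nat.cast_nonneg p)] at hmain
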